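/- **Proposition 3.2.** Let $\alpha,\beta,\gamma>-1$ and $\delta\in\mathbb R\setminus\{1,-1\}$. For an integer $n\ge 0$ let $$J_n(x;a,b,c)=\begin{cases}{}_2F_1\!\left(-\tfrac n2,\tfrac{n+a+b+2}2;\tfrac{a+1}2;\tfrac{1-x^2}{1-c^2}\right)+\tfrac{n(1-x)}{(1+c)(a+1)}\,{}_2F_1\!\left(1-\tfrac n2,\tfrac{n+a+b+2}2;\tfrac{a+3}2;\tfrac{1-x^2}{1-c^2}\right),& n\text{ even},\\[2mm]{}_2F_1\!\left(-\tfrac{n-1}2,\tfrac{n+a+b+1}2;\tfrac{a+1}2;\tfrac{1-x^2}{1-c^2}\right)-\tfrac{(n+a+b+1)(1-x)}{(1+c)(a+1)}\,{}_2F_1\!\left(-\tfrac{n-1}2,\tfrac{n+a+b+3}2;\tfrac{a+3}2;\tfrac{1-x^2}{1-c^2}\right),& n\text{ odd},\end{cases}$$ (the second term being $0$ for $n=0$) be the Big $-1$ Jacobi polynomials, let $\rho_k(y)=y^k(1-\delta^2/y^2)^{k/2}$ for $k$ even and $\rho_k(y)=y^k(1-\delta^2/y^2)^{(k-1)/2}(1+\delta/y)$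 for $k$ odd, and for integers $0\le k\le n$ let $$\mathcal J_{n,k}(x,y)=J_{n-k}\big(y;\alpha,2k+\beta+\gamma+1,(-1)^k\delta\big)\,\rho_k(y)\,J_k\!\left(\tfrac xy;\gamma,\beta,\tfrac\delta y\right)\qquad(y\ne0,\ y^2\ne\delta^2).$$ Each $\mathcal J_{n,k}$ is given by a unique polynomial in $x,y$ with real coefficients, again denoted $\mathcal J_{n,k}$; put $\mathcal J_{n,k}=0$ for integers $n,k$ that do not satisfy $0\le k\le n$. Then, for all integers $0\le k\le n$, the following identities of polynomials hold: $$y\,\mathcal J_{n,k}=a_{n,k}\mathcal J_{n+1,k}+b_{n,k}\mathcal J_{n,k}+c_{n,k}\mathcal J_{n-1,k},$$ $$\begin{aligned}x\,\mathcal J_{n,k}={}&e_{n,k}\mathcal J_{n+1,k-1}+f_{n,k}\mathcal J_{n+1,k}+g_{n,k}\mathcal J_{n+1,k+1}+r_{n,k}\mathcal J_{n,k-1}+s_{n,k}\mathcal J_{n,k}+t_{n,k}\mathcal J_{n,k+1}\\&+u_{n,k}\mathcal J_{n-1,k-1}+v_{n,k}\mathcal J_{n-1,k}+w_{n,k}\mathcal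 J_{n-1,k+1}.\end{aligned}$$ Here $S=\alpha+\beta+\gamma$, $\delta_n=(-1)^n\delta$, $\phi_k=(1-(-1)^k)/2$, $$\tau_k=\frac{k+\beta\phi_k}{2k+\beta+\gamma},\qquad \sigma_k=\frac{k+\beta\phi_k+\gamma+1}{2k+\beta+\gamma+2},\qquad z_n=\frac{(-1)^n-\delta(2n+S+2)}{(2n+S+1)(2n+S+3)},$$ and, writing $[p\,|\,q]$ for $p$ if $n+k$ is even and $q$ if $n+k$ is odd, $$\begin{aligned} a_{n,k}&=\frac{1+\delta_n}{2n+S+3}\,[\,n-k+\alpha+1\,|\,n+k+S+2\,],\\ c_{n,k}&=\frac{1+\delta_{n+1}}{2n+S+1}\,[\,n-k\,|\,n+k+\beta+\gamma+1\,],\\ e_{n,k}&=\frac{\tau_k(1-\delta_k)(1+\delta_n)}{2n+S+3}\,[\,n-k+\alpha+1\,|\,n-k+\alpha+2\,],\\ g_{n,k}&=\frac{\sigma_k(1+\delta_n)}{(1+\delta_k)(2n+S+3)}\,[\,n+k+S+3\,|\,n+k+S+2\,],\\ r_{n,k}&=2\tau_kz_n\big((-1)^k-\delta\big)\,[\,n-k+\alpha+1\,|\,n+k+\beta+\gamma+1\,],\\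 t_{n,k}&=\frac{2(-1)^{k+1}\sigma_kz_n}{1+\delta_k}\,[\,n-k\,|\,n+k+S+2\,],\\ u_{n,k}&=\frac{\tau_k(1-\delta_k)(1-\delta_n)}{2n+S+1}\,[\,n+k+\beta+\gamma\,|\,n+k+\beta+\gamma+1\,],\\ w_{n,k}&=\frac{\sigma_k(1-\delta_n)}{(1+\delta_k)(2n+S+1)}\,[\,n-k\,|\,n-k-1\,], \end{aligned}$$ $$b_{n,k}=1-a_{n,k}-c_{n,k},\quad f_{n,k}=a_{n,k}(1-\sigma_k-\tau_k),\quad s_{n,k}=b_{n,k}(1-\sigma_k-\tau_k)-\delta_k(\sigma_k-\tau_k),\quad v_{n,k}=c_{n,k}(1-\sigma_k-\tau_k).$$ By convention $\tau_0=0$ and $c_{0,0}=0$ also when $\beta+\gamma=0$, respectively $S+1=0$; a term whose polynomial has inadmissible indices is zero, whatever its coefficient. -/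

import Mathlib

noncomputable section

namespace BigMinusOneJacobi

/-- The one-variable Big `-1` Jacobi polynomial `J_n(x; a, b, c)`; `₂F₁` is Mathlib's Gauss
hypergeometric function, here always a terminating sum (for `n = 0` the second one has the
prefactor `0`). -/
def bigJacobi (n : ℕ) (x a b c : ℝ) : ℝ :=
  if Even n then
    ordinaryHypergeometric (-(n : ℝ) / 2) ((n + a + b + 2) / 2) ((a + 1) / 2)
        ((1 - x ^ 2) / (1 - c ^ 2))
      + n * (1 - x) / ((1 + c) * (a + 1)) *
        ordinaryHypergeometric (1 - (n : ℝ) / 2) ((n + a + b + 2) / 2) ((a + 3) / 2)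
          ((1 - x ^ 2) / (1 - c ^ 2))
  else
    ordinaryHypergeometric (-((n : ℝ) - 1) / 2) ((n + a + b + 1) / 2) ((a + 1) / 2)
        ((1 - x ^ 2) / (1 - c ^ 2))
      - (n + a + b + 1) * (1 - x) / ((1 + c) * (a + 1)) *
        ordinaryHypergeometric (-((n : ℝ) - 1) / 2) ((n + a + b + 3) / 2) ((a + 3) / 2)
          ((1 - x ^ 2) / (1 - c ^ 2))

/-- The factor `ρ_k(y)`. The exponents `k / 2` and `(k - 1) / 2` are exact divisions in `ℕ`. -/
def rho (δ : ℝ) (k : ℕ) (y : ℝ) : ℝ :=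
  if Even k then y ^ k * (1 - δ ^ 2 / y ^ 2) ^ (k / 2)
  else y ^ k * (1 - δ ^ 2 / y ^ 2) ^ ((k - 1) / 2) * (1 + δ / y)

/-- The defining formula of the two-variable Big `-1` Jacobi polynomial `𝒥_{n,k}(x, y)`,
for `k ≤ n`. As a formula it makes sense for `y ≠ 0` and `y² ≠ δ²`. -/
def twoVarBigJacobi (α β γ δ : ℝ) (n k : ℕ) (x y : ℝ) : ℝ :=
  bigJacobi (n - k) y α (2 * k + β + γ + 1) ((-1) ^ k * δ) * rho δ k y *
    bigJacobi k (x / y) γ β (δ / y)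

/-- `𝒥` is the family of two-variable Big `-1` Jacobi polynomials: for `0 ≤ k ≤ n`, `𝒥 n k` is
the polynomial in `x` (variable `0`) and `y` (variable `1`) that is given by the defining formula
wherever that formula makes sense, and `𝒥 n k = 0` for all other indices. -/
def IsTwoVarBigJacobi (α β γ δ : ℝ) (𝒥 : ℤ → ℤ → MvPolynomial (Fin 2) ℝ) : Prop :=
  (∀ n k : ℕ, k ≤ n → ∀ x y : ℝ, y ≠ 0 → y ^ 2 ≠ δ ^ 2 →
    MvPolynomial.eval ![x, y] (𝒥 n k) = twoVarBigJacobi α β γ δ n k x y) ∧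
  (∀ n k : ℤ, ¬(0 ≤ k ∧ k ≤ n) → 𝒥 n k = 0)

/-- `δ_n = (-1)^n δ`. -/
def dlt (δ : ℝ) (n : ℕ) : ℝ := (-1) ^ n * δ

/-- The characteristic function of the odd numbers. -/
def phi (k : ℕ) : ℝ := (1 - (-1) ^ k) / 2

/- In the following coefficients a quotient with numerator identically zero is zero, also where
its denominator vanishes: this concerns `tau` at `k = 0`, `β + γ = 0` and `coefC` at `n = k = 0`,
`α + β + γ + 1 = 0`. Every other coefficient that multiplies a polynomial with admissible
indices has nonzero denominators. -/

def tau (β γ : ℝ) (k : ℕ) : ℝ := (k + β * phi k) / (2 * k + β + γ)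

def sigma (β γ : ℝ) (k : ℕ) : ℝ := (k + β * phi k + γ + 1) / (2 * k + β + γ + 2)

def zee (α β γ δ : ℝ) (n : ℕ) : ℝ :=
  ((-1) ^ n - δ * (2 * n + α + β + γ + 2)) /
    ((2 * n + α + β + γ + 1) * (2 * n + α + β + γ + 3))

def coefA (α β γ δ : ℝ) (n k : ℕ) : ℝ :=
  (1 + dlt δ n) / (2 * n + α + β + γ + 3) *
    (if Even (n + k) then (n : ℝ) - k + α + 1 else (n : ℝ) + k + α + β + γ + 2)

def coefC (α β γ δ : ℝ) (n k : ℕ) : ℝ :=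
  (1 + dlt δ (n + 1)) / (2 * n + α + β + γ + 1) *
    (if Even (n + k) then (n : ℝ) - k else (n : ℝ) + k + β + γ + 1)

def coefB (α β γ δ : ℝ) (n k : ℕ) : ℝ := 1 - coefA α β γ δ n k - coefC α β γ δ n k

def coefE (α β γ δ : ℝ) (n k : ℕ) : ℝ :=
  tau β γ k * (1 - dlt δ k) * (1 + dlt δ n) / (2 * n + α + β + γ + 3) *
    (if Even (n + k) then (n : ℝ) - k + α + 1 else (n : ℝ) - k + α + 2)

def coefF (α β γ δ : ℝ) (n k : ℕ) : ℝ :=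
  coefA α β γ δ n k * (1 - sigma β γ k - tau β γ k)

def coefG (α β γ δ : ℝ) (n k : ℕ) : ℝ :=
  sigma β γ k * (1 + dlt δ n) / ((1 + dlt δ k) * (2 * n + α + β + γ + 3)) *
    (if Even (n + k) then (n : ℝ) + k + α + β + γ + 3 else (n : ℝ) + k + α + β + γ + 2)

def coefR (α β γ δ : ℝ) (n k : ℕ) : ℝ :=
  2 * tau β γ k * zee α β γ δ n * ((-1) ^ k - δ) *
    (if Even (n + k) then (n : ℝ) - k + α + 1 else (n : ℝ) + k + β + γ + 1)

def coefS (α β γ δ : ℝ) (n k : ℕ) : ℝ :=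
  coefB α β γ δ n k * (1 - sigma β γ k - tau β γ k) - dlt δ k * (sigma β γ k - tau β γ k)

def coefT (α β γ δ : ℝ) (n k : ℕ) : ℝ :=
  2 * (-1) ^ (k + 1) * sigma β γ k * zee α β γ δ n / (1 + dlt δ k) *
    (if Even (n + k) then (n : ℝ) - k else (n : ℝ) + k + α + β + γ + 2)

def coefU (α β γ δ : ℝ) (n k : ℕ) : ℝ :=
  tau β γ k * (1 - dlt δ k) * (1 - dlt δ n) / (2 * n + α + β + γ + 1) *
    (if Even (n + k) then (n : ℝ) + k + β + γ else (n : ℝ) + k + β + γ + 1)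

def coefV (α β γ δ : ℝ) (n k : ℕ) : ℝ :=
  coefC α β γ δ n k * (1 - sigma β γ k - tau β γ k)

def coefW (α β γ δ : ℝ) (n k : ℕ) : ℝ :=
  sigma β γ k * (1 - dlt δ n) / ((1 + dlt δ k) * (2 * n + α + β + γ + 1)) *
    (if Even (n + k) then (n : ℝ) - k else (n : ℝ) - k - 1)

end BigMinusOneJacobi

end

/-!
Since `𝒥_{n,k}(x, y) = J_{n-k}(y; α, 2k+β+γ+1, (-1)^k δ) · Q_k(x, y)` with
`Q_k = ρ_k(y) J_k(x/y; γ, β, δ/y)`, the recurrences reduce to three facts on the one-variable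
polynomials `J_n(x; a, b, c)`.

* `mul_bigJacobi`, their three-term recurrence. In the variable `y` it is the first identity; in the
  variable `x/y`, multiplied by `y ρ_k(y)`, it becomes `mul_homJacobi`, which expresses `x Q_k` by
  `Q_{k+1}`, `y Q_k`, `Q_k` and `(y - δ_k)² Q_{k-1}`.
* `bigJacobi_raise`, which passes from the parameters `(a, b, c)` to `(a, b+2, -c)`. These are the
  parameters belonging to `k + 1`, so it turns the term with `Q_{k+1}` into three `𝒥_{·,k+1}`.
* `sq_mul_bigJacobi_lower`, which goes back from `(a, b+2, -c)` to `(a, b, c)` at the cost of a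
  factor `(x + c)²`. This is the factor `(y - δ_k)²`, so the term with `Q_{k-1}` turns into three
  `𝒥_{·,k-1}`.

The middle term of `mul_homJacobi` is treated by the three-term recurrence in `y` again.

All three facts come from contiguous relations. With `z = (1 - x²)/(1 - c²)` every `J_n` has
the form `F(z) + (1 - x) G(z)` with terminating Gauss series `F` and `G`; the change
`(a, b, c) ↦ (a, b+2, -c)` fixes `z`, and `x² = 1 - (1 - c²) z`. Comparing the two components leaves linear relations between
contiguous `₂F₁`, and these hold coefficient by coefficient.

A polynomial identity may be tested off the curve `y (y² - δ²) = 0`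
(`mvPolynomial_eq_of_eval_eq`), where the defining formula of `𝒥_{n,k}` is valid. The polynomials
exist because `ρ_k(y)` is, up to the factor `y + δ` for odd `k`, the power of `y² - δ²` that clears
the denominators of the series in `(y² - x²)/(y² - δ²)`.
-/

namespace BigMinusOneJacobi

/-! ### Contiguous relations of terminating hypergeometric series -/

section

open Polynomial Finset

lemma ascPochhammer_eval_shift (A : ℝ) (j : ℕ) :
    A * (ascPochhammer ℝ j).eval (A + 1) = (ascPochhammer ℝ j).eval A * (A + j) := by
  rw [← ascPochhammer_succ_eval, ascPochhammer_succ_left]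
  simp

lemma ascPochhammer_eval_succ_left (A : ℝ) (j : ℕ) :
    (ascPochhammer ℝ (j + 1)).eval A = A * (ascPochhammer ℝ j).eval (A + 1) := by
  rw [ascPochhammer_succ_left]
  simp

/-- The hypergeometric series `₂F₁(A, B; C; z)` truncated after `N` terms. -/
noncomputable def truncF (N : ℕ) (A B C z : ℝ) : ℝ :=
  ∑ j ∈ range N, ordinaryHypergeometricCoefficient A B C j * z ^ j

lemma truncF_comm (N : ℕ) (A B C z : ℝ) : truncF N A B C z = truncF N B A C z := by
  unfold truncF ordinaryHypergeometricCoefficient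
  exact sum_congr rfl fun j _ => by ring

/-- `(A - B) F = A F(A + 1) - B F(B + 1)`. This and the next three relations hold for the
truncations because they hold coefficient by coefficient in `z`. -/
lemma truncF_sub_mul (N : ℕ) (A B C z : ℝ) :
    (A - B) * truncF N A B C z = A * truncF N (A + 1) B C z - B * truncF N A (B + 1) C z := by
  simp only [truncF, mul_sum, ← sum_sub_distrib, ordinaryHypergeometricCoefficient]
  refine sum_congr rfl fun j _ => ?_
  have hA := ascPochhammer_eval_shift A j
  have hB := ascPochhammer_eval_shift B j
  set q := ((j.factorial : ℝ))⁻¹ * ((ascPochhammer ℝ j).eval C)⁻¹ * z ^ j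
  linear_combination (-q * (ascPochhammer ℝ j).eval B) * hA +
    (q * (ascPochhammer ℝ j).eval A) * hB

/-- `C F = (C - A) F(C + 1) + A F(A + 1; C + 1)`. -/
lemma truncF_lower {C : ℝ} (hC : 0 < C) (N : ℕ) (A B z : ℝ) :
    C * truncF N A B C z =
      (C - A) * truncF N A B (C + 1) z + A * truncF N (A + 1) B (C + 1) z := by
  simp only [truncF, mul_sum, ← sum_add_distrib, ordinaryHypergeometricCoefficient]
  refine sum_congr rfl fun j _ => ?_
  have hA := ascPochhammer_eval_shift A j
  have hC1 := ascPochhammer_eval_shift C j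
  have h0 := (ascPochhammer_pos j C hC).ne'
  have h1 := (ascPochhammer_pos j (C + 1) (by linarith)).ne'
  have h2 : C * ((ascPochhammer ℝ j).eval C)⁻¹ =
      ((ascPochhammer ℝ j).eval (C + 1))⁻¹ * (C + j) := by
    field_simp
    linarith
  set q := ((j.factorial : ℝ))⁻¹ * (ascPochhammer ℝ j).eval B * z ^ j
  linear_combination (-q * ((ascPochhammer ℝ j).eval (C + 1))⁻¹) * hA +
    (q * (ascPochhammer ℝ j).eval A) * h2

/-- `C (F(B + 1) - F) = A z F(A + 1, B + 1; C + 1)`; the factor `z` costs one term of the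
truncation. -/
lemma truncF_shift_sub {C : ℝ} (hC : 0 < C) (N : ℕ) (A B z : ℝ) :
    C * (truncF (N + 1) A (B + 1) C z - truncF (N + 1) A B C z) =
      A * z * truncF N (A + 1) (B + 1) (C + 1) z := by
  simp only [truncF, sum_range_succ' _ N, mul_sum, mul_sub, mul_add,
    ordinaryHypergeometricCoefficient, Nat.factorial_succ, ascPochhammer_eval_succ_left]
  simp only [ascPochhammer_zero, eval_one, add_sub_add_right_eq_sub, ← sum_sub_distrib]
  refine sum_congr rfl fun j _ => ?_
  have hB := ascPochhammer_eval_shift (B + 1) j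
  have h1 := (ascPochhammer_pos j (C + 1) (by linarith)).ne'
  have hj : (j.factorial : ℝ) ≠ 0 := by positivity
  push_cast
  field_simp
  linear_combination A * (ascPochhammer ℝ j).eval (A + 1) * z ^ (j + 1) * hB

/-- `(A - B) (1 - z) F(A + 1, B + 1) = (A + 1 - C) F(B + 1) - (B + 1 - C) F(A + 1)`. -/
lemma truncF_one_sub_mul {C : ℝ} (hC : 0 < C) (N : ℕ) (A B z : ℝ) :
    (A - B) * (truncF (N + 1) (A + 1) (B + 1) C z - z * truncF N (A + 1) (B + 1) C z) =
      (A + 1 - C) * truncF (N + 1) A (B + 1) C z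
        - (B + 1 - C) * truncF (N + 1) (A + 1) B C z := by
  simp only [truncF, sum_range_succ' _ N, mul_sum, mul_sub, mul_add,
    ordinaryHypergeometricCoefficient, Nat.factorial_succ]
  have key : ∀ j : ℕ, (A - B) * ((((j + 1) * j.factorial : ℕ) : ℝ)⁻¹ *
        (ascPochhammer ℝ (j + 1)).eval (A + 1) * (ascPochhammer ℝ (j + 1)).eval (B + 1) *
        ((ascPochhammer ℝ (j + 1)).eval C)⁻¹ * z ^ (j + 1)) -
      (A - B) * (z * ((j.factorial : ℝ)⁻¹ * (ascPochhammer ℝ j).eval (A + 1) *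
        (ascPochhammer ℝ j).eval (B + 1) * ((ascPochhammer ℝ j).eval C)⁻¹ * z ^ j)) =
      (A + 1 - C) * ((((j + 1) * j.factorial : ℕ) : ℝ)⁻¹ *
        (ascPochhammer ℝ (j + 1)).eval A * (ascPochhammer ℝ (j + 1)).eval (B + 1) *
        ((ascPochhammer ℝ (j + 1)).eval C)⁻¹ * z ^ (j + 1)) -
      (B + 1 - C) * ((((j + 1) * j.factorial : ℕ) : ℝ)⁻¹ *
        (ascPochhammer ℝ (j + 1)).eval (A + 1) * (ascPochhammer ℝ (j + 1)).eval B *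
        ((ascPochhammer ℝ (j + 1)).eval C)⁻¹ * z ^ (j + 1)) := by
    intro j
    rw [ascPochhammer_eval_succ_left A, ascPochhammer_eval_succ_left B]
    simp only [ascPochhammer_succ_eval]
    have h1 := (ascPochhammer_pos j C hC).ne'
    have h2 : C + j ≠ 0 := by positivity
    have hj : (j.factorial : ℝ) ≠ 0 := by positivity
    push_cast
    field_simp
    ring
  have := sum_congr rfl fun j (_ : j ∈ range N) => key j
  simp only [sum_sub_distrib] at this
  simp only [ascPochhammer_zero, eval_one]
  linear_combination this

/-- The terminating hypergeometric polynomial `₂F₁(-m, B; C; z)`. -/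
noncomputable def hyperPoly (m : ℕ) (B C z : ℝ) : ℝ := truncF (m + 1) (-m) B C z

lemma hyperCoeff_eq_zero {m j : ℕ} (h : m < j) (B C : ℝ) :
    ordinaryHypergeometricCoefficient (-(m : ℝ)) B C j = 0 := by
  simp [ordinaryHypergeometricCoefficient, ascPochhammer_eval_neg_coe_nat_of_lt h]

lemma truncF_neg_nat {m N : ℕ} (h : m < N) (B C z : ℝ) :
    truncF N (-m) B C z = hyperPoly m B C z := by
  refine (sum_subset (range_subset_range.2 h) fun j _ hj => ?_).symm
  rw [hyperCoeff_eq_zero (by simpa using hj), zero_mul]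

lemma truncF_neg_nat_succ {m N : ℕ} (h : m < N) (B C z : ℝ) :
    truncF N (-((m + 1 : ℕ) : ℝ) + 1) B C z = hyperPoly m B C z := by
  rw [← truncF_neg_nat h]
  congr 1
  push_cast
  ring

/-- `m ₂F₁(1 - m, B; C; z)` terminates also for `m = 0`, because of the prefactor. -/
lemma mul_truncF_pred {m N : ℕ} (h : m ≤ N) (B C z : ℝ) :
    (m : ℝ) * truncF N (-m + 1) B C z = m * hyperPoly (m - 1) B C z := by
  cases m with
  | zero => simp
  | succ m => rw [truncF_neg_nat_succ (by omega), Nat.add_sub_cancel]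

lemma ordinaryHypergeometric_neg_nat (m : ℕ) (B C z : ℝ) :
    ordinaryHypergeometric (-(m : ℝ)) B C z = hyperPoly m B C z := by
  rw [ordinaryHypergeometric_eq_tsum, hyperPoly, truncF]
  refine tsum_eq_sum fun j hj => ?_
  have := hyperCoeff_eq_zero (show m < j by simpa using hj) B C
  rw [ordinaryHypergeometricCoefficient] at this
  rw [this, zero_smul]

lemma hyperPoly_zero (B C z : ℝ) : hyperPoly 0 B C z = 1 := by
  simp [hyperPoly, truncF, ordinaryHypergeometricCoefficient]

/-- For `m = 0` the junk index `m - 1 = 0` is harmless, here and below, since `m` multiplies it. -/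
lemma hyperPoly_add_mul (m : ℕ) (B C z : ℝ) :
    (m + B) * hyperPoly m B C z =
      m * hyperPoly (m - 1) B C z + B * hyperPoly m (B + 1) C z := by
  have h := truncF_sub_mul (m + 1) (-m) B C z
  rw [neg_mul, mul_truncF_pred (by omega)] at h
  simp only [truncF_neg_nat (Nat.lt_succ_self m)] at h
  linear_combination -h

lemma hyperPoly_lower_left {C : ℝ} (hC : 0 < C) (m : ℕ) (B z : ℝ) :
    C * hyperPoly m B C z =
      (C + m) * hyperPoly m B (C + 1) z - m * hyperPoly (m - 1) B (C + 1) z := by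
  have h := truncF_lower hC (m + 1) (-m) B z
  rw [neg_mul, mul_truncF_pred (by omega)] at h
  simp only [truncF_neg_nat (Nat.lt_succ_self m)] at h
  linear_combination h

lemma hyperPoly_lower_right {C : ℝ} (hC : 0 < C) (m : ℕ) (B z : ℝ) :
    C * hyperPoly m B C z =
      (C - B) * hyperPoly m B (C + 1) z + B * hyperPoly m (B + 1) (C + 1) z := by
  have h := truncF_lower hC (m + 1) B (-m) z
  simpa only [truncF_comm _ B, truncF_comm _ (B + 1), truncF_neg_nat (Nat.lt_succ_self m)] using h

lemma hyperPoly_shift_right_sub {C : ℝ} (hC : 0 < C) (m : ℕ) (B z : ℝ) :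
    C * (hyperPoly m (B + 1) C z - hyperPoly m B C z) =
      -(m * z * hyperPoly (m - 1) (B + 1) (C + 1) z) := by
  have h := truncF_shift_sub hC (m + 1) (-m) B z
  have h' := mul_truncF_pred (show m ≤ m + 1 by omega) (B + 1) (C + 1) z
  simp only [truncF_neg_nat (show m < m + 1 + 1 by omega)] at h
  linear_combination h - z * h'

lemma hyperPoly_shift_left_sub {C : ℝ} (hC : 0 < C) (m : ℕ) (B z : ℝ) :
    C * (hyperPoly m B C z - hyperPoly (m + 1) B C z) =
      B * z * hyperPoly m (B + 1) (C + 1) z := by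
  have h := truncF_shift_sub hC (m + 1) B (-((m + 1 : ℕ) : ℝ)) z
  simpa only [truncF_comm _ B, truncF_comm _ (B + 1),
    truncF_neg_nat_succ (show m < m + 1 + 1 by omega),
    truncF_neg_nat_succ (show m < m + 1 by omega),
    truncF_neg_nat (show m + 1 < m + 1 + 1 by omega)] using h

lemma hyperPoly_one_sub_mul {C : ℝ} (hC : 0 < C) (m : ℕ) (B z : ℝ) :
    (m + 1 + B) * (1 - z) * hyperPoly m (B + 1) C z =
      (m + C) * hyperPoly (m + 1) (B + 1) C z + (B + 1 - C) * hyperPoly m B C z := by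
  have h := truncF_one_sub_mul hC (m + 1) (-((m + 1 : ℕ) : ℝ)) B z
  simp only [truncF_neg_nat_succ (show m < m + 1 + 1 by omega),
    truncF_neg_nat_succ (show m < m + 1 by omega),
    truncF_neg_nat (show m + 1 < m + 1 + 1 by omega)] at h
  push_cast at h
  linear_combination -h

/-- The difference that produces `J_{2m+1} - J_{2m+2}` and so carries the three-term recurrence. -/
lemma hyperPoly_diag_sub {C : ℝ} (hC : 0 < C) (m : ℕ) (B z : ℝ) :
    C * (hyperPoly m B C z - hyperPoly (m + 1) (B + 1) C z) =
      (B + m + 1) * z * hyperPoly m (B + 1) (C + 1) z := by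
  have h1 := hyperPoly_shift_left_sub hC m B z
  have h2 := hyperPoly_shift_right_sub hC (m + 1) B z
  rw [Nat.add_sub_cancel] at h2
  push_cast at h2
  linear_combination h1 - h2

end

/-! ### The three-term recurrence in one variable -/

/-- With `e = (a + 1) / 2` and `u = (a + b + 2) / 2` in place of `a` and `b`, the polynomial
`J_{2m}` is written in the basis `1, 1 - x` over the polynomials in `(1 - x²) / (1 - c²)`. -/
lemma bigJacobi_even (m : ℕ) (x e u c : ℝ) :
    bigJacobi (2 * m) x (2 * e - 1) (2 * u - 2 * e - 1) c =
      hyperPoly m (m + u) e ((1 - x ^ 2) / (1 - c ^ 2)) +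
      m * (1 - x) / ((1 + c) * e) *
        hyperPoly (m - 1) (m + u) (e + 1) ((1 - x ^ 2) / (1 - c ^ 2)) := by
  rw [bigJacobi, if_pos (even_two_mul m)]
  have hB : (((2 * m : ℕ) : ℝ) + (2 * e - 1) + (2 * u - 2 * e - 1) + 2) / 2 = m + u := by
    push_cast; ring
  have hA : -((2 * m : ℕ) : ℝ) / 2 = -(m : ℝ) := by push_cast; ring
  have hC : (2 * e - 1 + 1) / 2 = e := by ring
  have hC' : (2 * e - 1 + 3) / 2 = e + 1 := by ring
  rw [hA, hB, hC, hC', ordinaryHypergeometric_neg_nat]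
  cases m with
  | zero => simp
  | succ m =>
    have hA' : 1 - ((2 * (m + 1) : ℕ) : ℝ) / 2 = -(m : ℝ) := by push_cast; ring
    rw [hA', ordinaryHypergeometric_neg_nat, Nat.add_sub_cancel,
      Nat.cast_mul, Nat.cast_ofNat, sub_add_cancel, mul_assoc 2, mul_left_comm (1 + c) 2,
      mul_div_mul_left _ _ two_ne_zero]

/-- The analogue of `bigJacobi_even` for `J_{2m+1}`. -/
lemma bigJacobi_odd (m : ℕ) (x e u c : ℝ) :
    bigJacobi (2 * m + 1) x (2 * e - 1) (2 * u - 2 * e - 1) c =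
      hyperPoly m (m + u) e ((1 - x ^ 2) / (1 - c ^ 2)) -
      (m + u) * (1 - x) / ((1 + c) * e) *
        hyperPoly m (m + u + 1) (e + 1) ((1 - x ^ 2) / (1 - c ^ 2)) := by
  rw [bigJacobi, if_neg (by simp)]
  have hB : (((2 * m + 1 : ℕ) : ℝ) + (2 * e - 1) + (2 * u - 2 * e - 1) + 1) = 2 * (m + u) := by
    push_cast; ring
  have hB' : (((2 * m + 1 : ℕ) : ℝ) + (2 * e - 1) + (2 * u - 2 * e - 1) + 3) / 2 = m + u + 1 := by
    push_cast; ring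
  have hA : -(((2 * m + 1 : ℕ) : ℝ) - 1) / 2 = -(m : ℝ) := by push_cast; ring
  have hC : (2 * e - 1 + 1) / 2 = e := by ring
  have hC' : (2 * e - 1 + 3) / 2 = e + 1 := by ring
  rw [hA, hB, hB', hC, hC', ordinaryHypergeometric_neg_nat, ordinaryHypergeometric_neg_nat,
    mul_div_cancel_left₀ _ two_ne_zero, sub_add_cancel, mul_assoc 2, mul_left_comm (1 + c) 2,
      mul_div_mul_left _ _ two_ne_zero]

/-- The coefficient of `J_{n+1}` in `x J_n`. -/
noncomputable def upCoeff (n : ℕ) (a b c : ℝ) : ℝ :=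
  (1 + (-1) ^ n * c) / (2 * n + a + b + 2) * (if Even n then n + a + 1 else n + a + b + 1)

/-- The coefficient of `J_{n-1}` in `x J_n`. -/
noncomputable def downCoeff (n : ℕ) (a b c : ℝ) : ℝ :=
  (1 - (-1) ^ n * c) / (2 * n + a + b) * (if Even n then (n : ℝ) else n + b)

lemma exists_half_params (a b : ℝ) : ∃ e u : ℝ, a = 2 * e - 1 ∧ b = 2 * u - 2 * e - 1 :=
  ⟨(a + 1) / 2, (a + b + 2) / 2, by ring, by ring⟩

lemma bigJacobi_zero (x a b c : ℝ) : bigJacobi 0 x a b c = 1 := by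
  obtain ⟨e, u, rfl, rfl⟩ := exists_half_params a b
  have h := bigJacobi_even 0 x e u c
  simpa [hyperPoly_zero] using h

lemma upCoeff_even (m : ℕ) (e u c : ℝ) :
    upCoeff (2 * m) (2 * e - 1) (2 * u - 2 * e - 1) c = (1 + c) * (m + e) / (2 * m + u) := by
  rw [upCoeff, if_pos (even_two_mul m), pow_mul, neg_one_sq, one_pow,
    div_mul_eq_mul_div, ← mul_div_mul_left _ (2 * m + u) two_ne_zero]
  congr 1 <;> (push_cast; ring)

lemma upCoeff_odd (m : ℕ) (e u c : ℝ) :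
    upCoeff (2 * m + 1) (2 * e - 1) (2 * u - 2 * e - 1) c =
      (1 - c) * (m + u) / (2 * m + 1 + u) := by
  rw [upCoeff, if_neg (by simp), pow_succ, pow_mul, neg_one_sq, one_pow,
    div_mul_eq_mul_div, ← mul_div_mul_left _ (2 * m + 1 + u) two_ne_zero]
  congr 1 <;> (push_cast; ring)

lemma downCoeff_even (m : ℕ) (e u c : ℝ) :
    downCoeff (2 * m) (2 * e - 1) (2 * u - 2 * e - 1) c = (1 - c) * m / (2 * m - 1 + u) := by
  rw [downCoeff, if_pos (even_two_mul m), pow_mul, neg_one_sq, one_pow,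
    div_mul_eq_mul_div, ← mul_div_mul_left _ (2 * m - 1 + u) two_ne_zero]
  congr 1 <;> (push_cast; ring)

lemma downCoeff_odd (m : ℕ) (e u c : ℝ) :
    downCoeff (2 * m + 1) (2 * e - 1) (2 * u - 2 * e - 1) c =
      (1 + c) * (m + u - e) / (2 * m + u) := by
  rw [downCoeff, if_neg (by simp), pow_succ, pow_mul, neg_one_sq, one_pow,
    div_mul_eq_mul_div, ← mul_div_mul_left _ (2 * m + u) two_ne_zero]
  congr 1 <;> (push_cast; ring)

/-- The three-term recurrence of the one-variable polynomials. At `n = 0` the junk value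
`J_{n-1} = J_0` has coefficient zero. -/
theorem mul_bigJacobi {a b c : ℝ} (ha : -1 < a) (hb : -1 < b) (hc : 1 + c ≠ 0) (hc' : 1 - c ≠ 0)
    (n : ℕ) (x : ℝ) :
    x * bigJacobi n x a b c = upCoeff n a b c * bigJacobi (n + 1) x a b c +
      (1 - upCoeff n a b c - downCoeff n a b c) * bigJacobi n x a b c +
      downCoeff n a b c * bigJacobi (n - 1) x a b c := by
  obtain ⟨e, u, rfl, rfl⟩ := exists_half_params a b
  have he : 0 < e := by linarith
  have hu : 0 < u := by linarith
  have hcc : 1 - c ^ 2 = (1 + c) * (1 - c) := by ring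
  obtain ⟨m, rfl | rfl⟩ := n.even_or_odd'
  · rw [upCoeff_even, bigJacobi_odd, bigJacobi_even]
    cases m with
    | zero =>
      simp [downCoeff, hyperPoly_zero, bigJacobi_zero]
      field_simp
      ring
    | succ m =>
      rw [downCoeff_even, show 2 * (m + 1) - 1 = 2 * m + 1 by omega, bigJacobi_odd,
        Nat.add_sub_cancel]
      set z := (1 - x ^ 2) / (1 - c ^ 2) with hz
      -- The contiguous relations express all values through `p` and `g`, after which the claim is
      -- a rational identity.
      have h1 := hyperPoly_add_mul (m + 1) ((m + 1 : ℕ) + u) (e + 1) z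
      have h2 := hyperPoly_lower_left he (m + 1) ((m + 1 : ℕ) + u) z
      have h3 := hyperPoly_diag_sub he m (m + u) z
      rw [Nat.add_sub_cancel] at h1 h2
      push_cast at h1 h2 ⊢
      rw [show 2 * ((m : ℝ) + 1) - 1 + u = 2 * m + 1 + u by ring]
      rw [show (m : ℝ) + u + 1 = m + 1 + u by ring] at h3 ⊢
      have d1 : 2 * (m : ℝ) + 1 + u ≠ 0 := by positivity
      have d2 : 2 * ((m : ℝ) + 1) + u ≠ 0 := by positivity
      have d3 : (m : ℝ) + 1 + u ≠ 0 := by positivity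
      generalize hyperPoly (m + 1) (m + 1 + u + 1) (e + 1) z = h at *
      generalize hyperPoly (m + 1) (m + 1 + u) (e + 1) z = p at *
      generalize hyperPoly m (m + 1 + u) (e + 1) z = g at *
      generalize hyperPoly (m + 1) (m + 1 + u) e z = f at *
      generalize hyperPoly m (m + u) e z = f' at *
      have e1 : h = ((2 * (m + 1) + u) * p - (m + 1) * g) / (m + 1 + u) := by
        field_simp; linarith
      have e2 : f = ((e + (m + 1)) * p - (m + 1) * g) / e := by field_simp; linarith
      have e3 : f' = f + (m + 1 + u + m) * z * g / e := by field_simp; linarith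
      rw [e3, e2, e1, hz, hcc]
      field_simp
      ring
  · rw [upCoeff_odd, downCoeff_odd, show 2 * m + 1 + 1 = 2 * (m + 1) by ring, Nat.add_sub_cancel,
      bigJacobi_odd, bigJacobi_even, bigJacobi_even, Nat.add_sub_cancel]
    set z := (1 - x ^ 2) / (1 - c ^ 2) with hz
    -- The contiguous relations express all values through `g` and `h`, after which the claim is a
    -- rational identity.
    have h1 := hyperPoly_add_mul m (m + u) (e + 1) z
    have h2 := hyperPoly_lower_left he m (m + u) z
    have h3 := hyperPoly_diag_sub he m (m + u) z
    push_cast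
    rw [show (m : ℝ) + 1 + u = m + u + 1 by ring]
    have d1 : 2 * (m : ℝ) + 1 + u ≠ 0 := by positivity
    have d2 : 2 * (m : ℝ) + u ≠ 0 := by positivity
    generalize hyperPoly m (m + u + 1) (e + 1) z = h at *
    generalize hyperPoly m (m + u) (e + 1) z = p at *
    generalize hyperPoly (m - 1) (m + u) (e + 1) z = g at *
    generalize hyperPoly m (m + u) e z = f at *
    generalize hyperPoly (m + 1) (m + u + 1) e z = F at *
    have e1 : p = (m * g + (m + u) * h) / (2 * m + u) := by field_simp; linarith
    have e2 : f = ((e + m) * p - m * g) / e := by field_simp; linarith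
    have e3 : F = f - (m + u + m + 1) * z * h / e := by field_simp; linarith
    rw [e3, e2, e1, hz, hcc]
    field_simp
    ring

/-! ### Connection formulas between `(a, b, c)` and `(a, b + 2, -c)` -/

/-- The factor common to the coefficients of the middle terms of the two connection formulas. -/
noncomputable def midCoeff (n : ℕ) (a b c : ℝ) : ℝ :=
  ((-1) ^ n - c * (2 * n + a + b + 1)) / ((2 * n + a + b) * (2 * n + a + b + 2))

/-- Expansion of `J_n(x; a, b, c)` in the polynomials with parameters `(a, b + 2, -c)`. The junk
values at the truncated indices `n - 1` and `n - 2` have coefficient zero. The expansion is short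
because `(a, b + 2, -c)` leaves `(1 - x²) / (1 - c²)` unchanged and raises only the second numerator
parameter of the hypergeometric functions by one. -/
theorem bigJacobi_raise {a b c : ℝ} (ha : -1 < a) (hb : -1 < b) (hc : 1 + c ≠ 0)
    (hc' : 1 - c ≠ 0) (n : ℕ) (x : ℝ) :
    bigJacobi n x a b c =
      (1 + (-1) ^ n * c) / ((1 + c) * (2 * n + a + b + 2)) *
          (if Even n then n + a + b + 2 else n + a + b + 1) * bigJacobi n x a (b + 2) (-c) -
      2 * midCoeff n a b c / (1 + c) * (if Even n then (n : ℝ) else n + a + b + 1) *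
          bigJacobi (n - 1) x a (b + 2) (-c) +
      (1 - (-1) ^ n * c) / ((1 + c) * (2 * n + a + b)) * (if Even n then (n : ℝ) else n - 1) *
          bigJacobi (n - 2) x a (b + 2) (-c) := by
  obtain ⟨e, u, rfl, rfl⟩ := exists_half_params a b
  have he : 0 < e := by linarith
  have hu : 0 < u := by linarith
  rw [show 2 * u - 2 * e - 1 + 2 = 2 * (u + 1) - 2 * e - 1 by ring]
  obtain ⟨m, rfl | rfl⟩ := n.even_or_odd'
  · cases m with
    | zero =>
      have : 2 * e - 1 + (2 * u - 2 * e - 1) + 2 = 2 * u := by ring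
      simp [bigJacobi_zero, this]
      field_simp
    | succ m =>
      have hd1 : 2 * ((2 * (m + 1) : ℕ) : ℝ) + (2 * e - 1) + (2 * u - 2 * e - 1) =
        2 * (2 * m + 1 + u) := by push_cast; ring
      simp only [midCoeff, hd1, if_pos (even_two_mul (m + 1))]
      rw [show 2 * (2 * (m : ℝ) + 1 + u) + 2 = 2 * (2 * m + 2 + u) by ring,
        show 2 * (m + 1) - 1 = 2 * m + 1 by omega, show 2 * (m + 1) - 2 = 2 * m by omega]
      simp only [bigJacobi_even, bigJacobi_odd, neg_sq, Nat.add_sub_cancel, pow_mul (-1 : ℝ),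
        one_pow, ← sub_eq_add_neg]
      set z := (1 - x ^ 2) / (1 - c ^ 2)
      have h1 := hyperPoly_add_mul (m + 1) ((m + 1 : ℕ) + u) e z
      have h2 := hyperPoly_add_mul m ((m + 1 : ℕ) + u) (e + 1) z
      rw [Nat.add_sub_cancel] at h1
      push_cast at h1 h2 ⊢
      rw [← add_assoc (m : ℝ) u 1, ← add_assoc ((m : ℝ) + 1) u 1,
        show (m : ℝ) + u + 1 = m + 1 + u by ring]
      have d1 : 2 * (m : ℝ) + 1 + u ≠ 0 := by positivity
      have d2 : 2 * (m : ℝ) + 2 + u ≠ 0 := by positivity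
      generalize hyperPoly (m + 1) (m + 1 + u) e z = f at *
      generalize hyperPoly (m + 1) (m + 1 + u + 1) e z = f1 at *
      generalize hyperPoly m (m + 1 + u) e z = f2 at *
      generalize hyperPoly m (m + 1 + u) (e + 1) z = g at *
      generalize hyperPoly m (m + 1 + u + 1) (e + 1) z = g1 at *
      generalize hyperPoly (m - 1) (m + 1 + u) (e + 1) z = g3 at *
      have e1 : f = ((m + 1) * f2 + (m + 1 + u) * f1) / (2 * m + 2 + u) := by
        field_simp; linarith
      have e2 : g = (m * g3 + (m + 1 + u) * g1) / (2 * m + 1 + u) := by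
        field_simp; linarith
      rw [e1, e2]
      field_simp
      ring
  · have hd1 : 2 * ((2 * m + 1 : ℕ) : ℝ) + (2 * e - 1) + (2 * u - 2 * e - 1) =
      2 * (2 * m + u) := by push_cast; ring
    have hodd : ¬ Even (2 * m + 1) := by simp
    have hs : (-1 : ℝ) ^ (2 * m + 1) = -1 := Odd.neg_one_pow ⟨m, rfl⟩
    have d1 : 2 * (m : ℝ) + 1 + u ≠ 0 := by positivity
    have d2 : 2 * (m : ℝ) + u ≠ 0 := by positivity
    simp only [midCoeff, hd1, if_neg hodd]
    rw [show 2 * (2 * (m : ℝ) + u) + 2 = 2 * (2 * m + 1 + u) by ring, Nat.add_sub_cancel,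
      show 2 * m + 1 - 2 = 2 * m - 1 by omega]
    simp only [bigJacobi_even, bigJacobi_odd, neg_sq, hs, ← sub_eq_add_neg]
    set z := (1 - x ^ 2) / (1 - c ^ 2) with hz
    have h1 := hyperPoly_add_mul m (m + u) e z
    have h2 := hyperPoly_add_mul m (m + u + 1) (e + 1) z
    cases m with
    | zero =>
      simp [hyperPoly_zero] at d1 d2 ⊢
      field_simp
      ring
    | succ m =>
      rw [show 2 * (m + 1) - 1 = 2 * m + 1 by omega, bigJacobi_odd, neg_sq, ← hz, ← sub_eq_add_neg]
      rw [Nat.add_sub_cancel] at h1 h2 ⊢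
      push_cast at d1 d2 h1 h2 ⊢
      rw [← add_assoc (m : ℝ) u 1, ← add_assoc ((m : ℝ) + 1) u 1,
        show (m : ℝ) + u + 1 = m + 1 + u by ring]
      generalize hyperPoly (m + 1) (m + 1 + u) e z = f at *
      generalize hyperPoly (m + 1) (m + 1 + u + 1) e z = f1 at *
      generalize hyperPoly m (m + 1 + u) e z = f2 at *
      generalize hyperPoly (m + 1) (m + 1 + u + 1) (e + 1) z = h at *
      generalize hyperPoly m (m + 1 + u + 1) (e + 1) z = g1 at *
      generalize hyperPoly (m + 1) (m + 1 + u + 1 + 1) (e + 1) z = h1' at *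
      have e1 : f = ((m + 1) * f2 + (m + 1 + u) * f1) / (2 * (m + 1) + u) := by
        field_simp; linarith
      have e2 : h = ((m + 1) * g1 + (m + 1 + u + 1) * h1') / (2 * (m + 1) + 1 + u) := by
        field_simp; linarith
      rw [e1, e2]
      field_simp
      ring

/-- The inverse direction to `bigJacobi_raise`: multiplication by `(x + c)²` leads from the
parameters `(a, b + 2, -c)` back to `(a, b, c)`. -/
theorem sq_mul_bigJacobi_lower {a b c : ℝ} (ha : -1 < a) (hb : -1 < b) (hc : 1 + c ≠ 0)
    (hc' : 1 - c ≠ 0) (n : ℕ) (x : ℝ) :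
    (x + c) ^ 2 * bigJacobi n x a (b + 2) (-c) =
      (1 + c) * (1 - (-1) ^ n * c) / (2 * n + a + b + 4) *
          (if Even n then n + a + 1 else n + a + 2) * bigJacobi (n + 2) x a b c +
      2 * midCoeff n a (b + 2) (-c) * (1 + c) * (if Even n then n + a + 1 else n + b + 2) *
          bigJacobi (n + 1) x a b c +
      (1 + c) * (1 + (-1) ^ n * c) / (2 * n + a + b + 2) *
          (if Even n then n + b + 1 else n + b + 2) * bigJacobi n x a b c := by
  obtain ⟨e, u, rfl, rfl⟩ := exists_half_params a b
  have he : 0 < e := by linarith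
  have hu : 0 < u := by linarith
  have hcc : 1 - c ^ 2 = (1 + c) * (1 - c) := by ring
  rw [midCoeff, show 2 * u - 2 * e - 1 + 2 = 2 * (u + 1) - 2 * e - 1 by ring]
  obtain ⟨m, rfl | rfl⟩ := n.even_or_odd'
  · have d1 : 2 * (m : ℝ) + 1 + u ≠ 0 := by positivity
    have d2 : 2 * (m : ℝ) + u ≠ 0 := by positivity
    have d3 : (m : ℝ) + e ≠ 0 := by positivity
    have hd1 : 2 * ((2 * m : ℕ) : ℝ) + (2 * e - 1) + (2 * u - 2 * e - 1) + 2 =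
      2 * (2 * m + u) := by push_cast; ring
    have hd2 : 2 * ((2 * m : ℕ) : ℝ) + (2 * e - 1) + (2 * u - 2 * e - 1) + 4 =
      2 * (2 * m + 1 + u) := by push_cast; ring
    have hd3 : 2 * ((2 * m : ℕ) : ℝ) + (2 * e - 1) + (2 * (u + 1) - 2 * e - 1) =
      2 * (2 * m + u) := by push_cast; ring
    simp only [hd1, hd2, hd3, if_pos (even_two_mul m)]
    rw [show 2 * (2 * (m : ℝ) + u) + 2 = 2 * (2 * m + 1 + u) by ring,
      show 2 * m + 2 = 2 * (m + 1) by ring]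
    simp only [bigJacobi_even, bigJacobi_odd, neg_sq, Nat.add_sub_cancel, pow_mul (-1 : ℝ),
        one_pow, ← sub_eq_add_neg]
    set z := (1 - x ^ 2) / (1 - c ^ 2) with hz
    have h1 := hyperPoly_one_sub_mul he m (m + u) z
    have h2 := hyperPoly_shift_right_sub he m (m + u) z
    have h3 := hyperPoly_lower_left he m (m + u + 1) z
    have h4 : m * ((2 * m + u) * (1 - z) * hyperPoly (m - 1) (m + u + 1) (e + 1) z) =
        m * ((m + e) * hyperPoly m (m + u + 1) (e + 1) z +
          (m + u - e) * hyperPoly (m - 1) (m + u) (e + 1) z) := by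
      cases m with
      | zero => simp
      | succ m =>
        have := hyperPoly_one_sub_mul (show 0 < e + 1 by linarith) m ((m + 1 : ℕ) + u) z
        simp only [Nat.add_sub_cancel]
        push_cast at this ⊢
        linear_combination (m + 1 : ℝ) * this
    push_cast
    rw [← add_assoc (m : ℝ) u 1, show (m : ℝ) + 1 + u = m + u + 1 by ring]
    generalize hyperPoly m (m + u) e z = f at *
    generalize hyperPoly m (m + u + 1) e z = f1 at *
    generalize hyperPoly (m + 1) (m + u + 1) e z = F at *
    generalize hyperPoly (m - 1) (m + u + 1) (e + 1) z = g1 at *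
    generalize hyperPoly (m - 1) (m + u) (e + 1) z = g at *
    generalize hyperPoly m (m + u + 1) (e + 1) z = h at *
    have e1 : F = ((2 * m + 1 + u) * (1 - z) * f1 - (m + u + 1 - e) * f) / (m + e) := by
      field_simp; linarith
    have e2 : f = f1 + m * z * g1 / e := by field_simp; linarith
    have e3 : h = (e * f1 + m * g1) / (e + m) := by field_simp; linarith
    -- `h4` cannot be solved for `g`, as `m * (m + u - e)` may vanish; it enters linearly.
    rw [e3] at h4
    rw [e1, e2, e3]
    rw [hz, hcc] at h4 ⊢
    linear_combination (norm := (field_simp; ring)) (1 - c) * (1 + c) * (1 - x) /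
      ((2 * m + u) * (1 - c) * e) * h4
  · have d1 : 2 * (m : ℝ) + 1 + u ≠ 0 := by positivity
    have d2 : 2 * (m : ℝ) + 2 + u ≠ 0 := by positivity
    have d3 : (m : ℝ) + e + 1 ≠ 0 := by positivity
    have hd1 : 2 * ((2 * m + 1 : ℕ) : ℝ) + (2 * e - 1) + (2 * u - 2 * e - 1) + 2 =
      2 * (2 * m + 1 + u) := by push_cast; ring
    have hd2 : 2 * ((2 * m + 1 : ℕ) : ℝ) + (2 * e - 1) + (2 * u - 2 * e - 1) + 4 =
      2 * (2 * m + 2 + u) := by push_cast; ring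
    have hd3 : 2 * ((2 * m + 1 : ℕ) : ℝ) + (2 * e - 1) + (2 * (u + 1) - 2 * e - 1) =
      2 * (2 * m + 1 + u) := by push_cast; ring
    have hodd : ¬ Even (2 * m + 1) := by simp
    have hs : (-1 : ℝ) ^ (2 * m + 1) = -1 := Odd.neg_one_pow ⟨m, rfl⟩
    simp only [hd1, hd2, hd3, if_neg hodd]
    rw [show 2 * (2 * (m : ℝ) + 1 + u) + 2 = 2 * (2 * m + 2 + u) by ring,
      show 2 * m + 1 + 2 = 2 * (m + 1) + 1 by ring, show 2 * m + 1 + 1 = 2 * (m + 1) by ring]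
    simp only [bigJacobi_even, bigJacobi_odd, neg_sq, Nat.add_sub_cancel, hs, ← sub_eq_add_neg]
    set z := (1 - x ^ 2) / (1 - c ^ 2) with hz
    have h1 := hyperPoly_one_sub_mul he m (m + u) z
    have h2 := hyperPoly_shift_left_sub he m (m + u + 1) z
    have h3 := hyperPoly_lower_right he m (m + u + 1) z
    have h4 := hyperPoly_one_sub_mul (show 0 < e + 1 by linarith) m (m + u + 1) z
    push_cast
    rw [← add_assoc (m : ℝ) u 1, show (m : ℝ) + 1 + u = m + u + 1 by ring]
    generalize hyperPoly m (m + u) e z = f at *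
    generalize hyperPoly m (m + u + 1) e z = f1 at *
    generalize hyperPoly (m + 1) (m + u + 1) e z = F at *
    generalize hyperPoly m (m + u + 1 + 1) (e + 1) z = h1' at *
    generalize hyperPoly (m + 1) (m + u + 1 + 1) (e + 1) z = H at *
    generalize hyperPoly m (m + u + 1) (e + 1) z = h at *
    have e1 : H = ((2 * m + 2 + u) * (1 - z) * h1' - (m + u + 1 - e) * h) / (m + e + 1) := by
      field_simp; linarith
    have e2 : f1 = ((e - (m + u + 1)) * h + (m + u + 1) * h1') / e := by field_simp; linarith
    have e3 : F = f1 - (m + u + 1) * z * h1' / e := by field_simp; linarith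
    -- `h1` cannot be solved for `f`, as `m + u + 1 - e` may vanish; it enters linearly.
    rw [e3, e2] at h1
    rw [e1, e3, e2]
    rw [hz, hcc] at h1 ⊢
    linear_combination (norm := (field_simp; ring)) (1 - c) * (1 + c) /
      (2 * m + 1 + u) * h1

/-! ### The two-variable polynomials: existence and uniqueness -/

section

open MvPolynomial

lemma exists_eval_eq_hyperPoly (m : ℕ) (B C c : ℝ) :
    ∃ p : MvPolynomial (Fin 2) ℝ, ∀ x y : ℝ,
      eval ![x, y] p = hyperPoly m B C ((1 - y ^ 2) / (1 - c ^ 2)) := by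
  refine ⟨∑ j ∈ Finset.range (m + 1),
    MvPolynomial.C (ordinaryHypergeometricCoefficient (-(m : ℝ)) B C j) *
      ((1 - X 1 ^ 2) * MvPolynomial.C (1 - c ^ 2)⁻¹) ^ j, fun x y => ?_⟩
  simp [hyperPoly, truncF, div_eq_mul_inv]

lemma exists_eval_eq_bigJacobi (n : ℕ) (a b c : ℝ) :
    ∃ p : MvPolynomial (Fin 2) ℝ, ∀ x y : ℝ, eval ![x, y] p = bigJacobi n y a b c := by
  obtain ⟨e, u, rfl, rfl⟩ := exists_half_params a b
  obtain ⟨m, rfl | rfl⟩ := n.even_or_odd'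
  · obtain ⟨p, hp⟩ := exists_eval_eq_hyperPoly m (m + u) e c
    obtain ⟨q, hq⟩ := exists_eval_eq_hyperPoly (m - 1) (m + u) (e + 1) c
    refine ⟨p + C (m / ((1 + c) * e)) * (1 - X 1) * q, fun x y => ?_⟩
    rw [bigJacobi_even]
    simp only [map_add, map_sub, map_mul, map_one, eval_C, eval_X, Matrix.cons_val_one,
      Matrix.cons_val_fin_one, hp, hq]
    ring
  · obtain ⟨p, hp⟩ := exists_eval_eq_hyperPoly m (m + u) e c
    obtain ⟨q, hq⟩ := exists_eval_eq_hyperPoly m (m + u + 1) (e + 1) c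
    refine ⟨p - C ((m + u) / ((1 + c) * e)) * (1 - X 1) * q, fun x y => ?_⟩
    rw [bigJacobi_odd]
    simp only [map_sub, map_mul, map_one, eval_C, eval_X, Matrix.cons_val_one,
      Matrix.cons_val_fin_one, hp, hq]
    ring

/-- The factor `(y² - δ²)^m` clears the denominators of the terminating series. -/
lemma exists_eval_eq_homogenized (δ : ℝ) (m : ℕ) (B C : ℝ) :
    ∃ p : MvPolynomial (Fin 2) ℝ, ∀ x y : ℝ, y ^ 2 ≠ δ ^ 2 →
      eval ![x, y] p =
        (y ^ 2 - δ ^ 2) ^ m * hyperPoly m B C ((y ^ 2 - x ^ 2) / (y ^ 2 - δ ^ 2)) := by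
  refine ⟨∑ j ∈ Finset.range (m + 1),
    MvPolynomial.C (ordinaryHypergeometricCoefficient (-(m : ℝ)) B C j) *
      ((X 1 ^ 2 - X 0 ^ 2) ^ j * (X 1 ^ 2 - MvPolynomial.C (δ ^ 2)) ^ (m - j)), fun x y h => ?_⟩
  have h0 : y ^ 2 - δ ^ 2 ≠ 0 := sub_ne_zero.2 h
  rw [hyperPoly, truncF, Finset.mul_sum, map_sum]
  refine Finset.sum_congr rfl fun j hj => ?_
  have hj' : j ≤ m := by simpa [Nat.lt_succ_iff] using hj
  rw [← pow_sub_mul_pow (y ^ 2 - δ ^ 2) hj', div_pow]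
  simp only [map_mul, map_sub, map_pow, eval_C, eval_X, Matrix.cons_val_zero, Matrix.cons_val_one]
  field_simp

/-- The factor `ρ_k(y) J_k(x/y; γ, β, δ/y)` of `𝒥_{n,k}(x, y)`. -/
noncomputable def homJacobi (β γ δ : ℝ) (k : ℕ) (x y : ℝ) : ℝ :=
  rho δ k y * bigJacobi k (x / y) γ β (δ / y)

lemma rho_even (δ : ℝ) (m : ℕ) {y : ℝ} (hy : y ≠ 0) :
    rho δ (2 * m) y = (y ^ 2 - δ ^ 2) ^ m := by
  rw [rho, if_pos (even_two_mul m), Nat.mul_div_cancel_left _ two_pos, pow_mul, ← mul_pow]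
  congr 1
  field_simp

lemma rho_odd (δ : ℝ) (m : ℕ) {y : ℝ} (hy : y ≠ 0) :
    rho δ (2 * m + 1) y = (y ^ 2 - δ ^ 2) ^ m * (y + δ) := by
  rw [rho, if_neg (by simp), Nat.add_sub_cancel, Nat.mul_div_cancel_left _ two_pos,
    ← rho_even δ m hy, rho, if_pos (even_two_mul m), Nat.mul_div_cancel_left _ two_pos, pow_succ]
  field_simp

lemma rho_succ (δ : ℝ) (k : ℕ) {y : ℝ} (hy : y ≠ 0) :
    rho δ (k + 1) y = (y + (-1) ^ k * δ) * rho δ k y := by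
  obtain ⟨m, rfl | rfl⟩ := k.even_or_odd'
  · rw [rho_odd δ m hy, rho_even δ m hy, pow_mul]
    simp [mul_comm]
  · rw [show 2 * m + 1 + 1 = 2 * (m + 1) by ring, rho_odd δ m hy, rho_even δ _ hy,
      Odd.neg_one_pow ⟨m, rfl⟩]
    ring

lemma exists_eval_eq_homJacobi (β γ δ : ℝ) (k : ℕ) :
    ∃ p : MvPolynomial (Fin 2) ℝ, ∀ x y : ℝ, y ≠ 0 → y ^ 2 ≠ δ ^ 2 →
      eval ![x, y] p = homJacobi β γ δ k x y := by
  obtain ⟨e, u, rfl, rfl⟩ := exists_half_params γ β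
  have hz : ∀ x y : ℝ, y ≠ 0 →
      (1 - (x / y) ^ 2) / (1 - (δ / y) ^ 2) = (y ^ 2 - x ^ 2) / (y ^ 2 - δ ^ 2) := by
    intro x y hy
    rw [← mul_div_mul_left (1 - (x / y) ^ 2) _ (pow_ne_zero 2 hy)]
    congr 1 <;> field_simp
  have hr : ∀ x y : ℝ, y ≠ 0 → (1 - x / y) / (1 + δ / y) = (y - x) / (y + δ) := by
    intro x y hy
    rw [← mul_div_mul_left (1 - x / y) _ hy]
    congr 1 <;> field_simp
  have hne : ∀ y : ℝ, y ^ 2 ≠ δ ^ 2 → y + δ ≠ 0 := by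
    intro y h h0
    exact h (by linear_combination (y - δ) * h0)
  obtain ⟨m, rfl | rfl⟩ := k.even_or_odd'
  · obtain ⟨p, hp⟩ := exists_eval_eq_homogenized δ m (m + u) e
    obtain ⟨q, hq⟩ := exists_eval_eq_homogenized δ (m - 1) (m + u) (e + 1)
    refine ⟨p + C (m / e) * (X 1 - X 0) * (X 1 - C δ) * q, fun x y hy h => ?_⟩
    have hs : (m : ℝ) * (1 - x / y) / ((1 + δ / y) * e) = m / e * ((y - x) / (y + δ)) := by
      rw [← hr x y hy, div_mul_div_comm, mul_comm e]
    rw [homJacobi, bigJacobi_even, rho_even δ m hy, hz x y hy, hs]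
    simp only [map_add, map_mul, map_sub, eval_C, eval_X, Matrix.cons_val_zero,
      Matrix.cons_val_one, hp x y h, hq x y h]
    have := hne y h
    cases m with
    | zero => simp
    | succ m =>
      rw [Nat.add_sub_cancel, pow_succ, show y ^ 2 - δ ^ 2 = (y - δ) * (y + δ) by ring]
      generalize hyperPoly _ _ _ _ = F
      generalize hyperPoly _ _ _ _ = G
      have hc : (y + δ) * ((y - x) / (y + δ)) = y - x := mul_div_cancel₀ _ this
      linear_combination -((m + 1 : ℕ) / e * ((y - δ) * (y + δ)) ^ m * (y - δ) * G) * hc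
  · obtain ⟨p, hp⟩ := exists_eval_eq_homogenized δ m (m + u) e
    obtain ⟨q, hq⟩ := exists_eval_eq_homogenized δ m (m + u + 1) (e + 1)
    refine ⟨(X 1 + C δ) * p - C ((m + u) / e) * (X 1 - X 0) * q, fun x y hy h => ?_⟩
    have hs : (m + u) * (1 - x / y) / ((1 + δ / y) * e) =
        (m + u) / e * ((y - x) / (y + δ)) := by
      rw [← hr x y hy, div_mul_div_comm, mul_comm e]
    rw [homJacobi, bigJacobi_odd, rho_odd δ m hy, hz x y hy, hs]
    simp only [map_add, map_mul, map_sub, eval_C, eval_X, Matrix.cons_val_zero,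
      Matrix.cons_val_one, hp x y h, hq x y h]
    generalize hyperPoly _ _ _ _ = F
    generalize hyperPoly _ _ _ _ = G
    have hc : (y + δ) * ((y - x) / (y + δ)) = y - x := mul_div_cancel₀ _ (hne y h)
    linear_combination ((m + u) / e * (y ^ 2 - δ ^ 2) ^ m * G) * hc

lemma twoVarBigJacobi_eq (α β γ δ : ℝ) (n k : ℕ) (x y : ℝ) :
    twoVarBigJacobi α β γ δ n k x y =
      bigJacobi (n - k) y α (2 * k + β + γ + 1) ((-1) ^ k * δ) * homJacobi β γ δ k x y := by
  rw [twoVarBigJacobi, homJacobi, mul_assoc]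

lemma exists_eval_eq_twoVarBigJacobi (α β γ δ : ℝ) (n k : ℕ) :
    ∃ p : MvPolynomial (Fin 2) ℝ, ∀ x y : ℝ, y ≠ 0 → y ^ 2 ≠ δ ^ 2 →
      eval ![x, y] p = twoVarBigJacobi α β γ δ n k x y := by
  obtain ⟨p, hp⟩ := exists_eval_eq_bigJacobi (n - k) α (2 * k + β + γ + 1) ((-1) ^ k * δ)
  obtain ⟨q, hq⟩ := exists_eval_eq_homJacobi β γ δ k
  exact ⟨p * q, fun x y hy h => by rw [map_mul, hp, hq x y hy h, twoVarBigJacobi_eq]⟩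

/-- Polynomials that agree off the curve `y (y² - δ²) = 0` are equal. -/
lemma mvPolynomial_eq_of_eval_eq (δ : ℝ) {p q : MvPolynomial (Fin 2) ℝ}
    (h : ∀ x y : ℝ, y ≠ 0 → y ^ 2 ≠ δ ^ 2 → eval ![x, y] p = eval ![x, y] q) : p = q := by
  -- The difference of `p` and `q` times this polynomial vanishes everywhere.
  have h0 : (X 1 * (X 1 ^ 2 - C (δ ^ 2)) : MvPolynomial (Fin 2) ℝ) ≠ 0 := by
    intro h0
    have h1 := congrArg (eval ![0, |δ| + 1]) h0
    simp only [map_mul, map_sub, map_pow, eval_C, eval_X, Matrix.cons_val_one, map_zero,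
      ← sq_abs δ] at h1
    have h2 := abs_nonneg δ
    have h3 : 0 < (|δ| + 1) * ((|δ| + 1) ^ 2 - |δ| ^ 2) :=
      mul_pos (by linarith) (by nlinarith)
    exact h3.ne' h1
  refine sub_eq_zero.1 ((mul_eq_zero.1 ?_).resolve_left h0)
  refine MvPolynomial.funext fun v => ?_
  have hv : v = ![v 0, v 1] := by
    ext i
    fin_cases i <;> rfl
  rw [hv]
  simp only [map_mul, map_sub, map_pow, eval_C, eval_X, Matrix.cons_val_one, map_zero]
  by_cases hy : v 1 = 0
  · simp [hy]
  by_cases hy' : v 1 ^ 2 = δ ^ 2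
  · simp [hy']
  rw [h _ _ hy hy', sub_self, mul_zero]

theorem existsUnique_isTwoVarBigJacobi (α β γ δ : ℝ) :
    ∃! 𝒥 : ℤ → ℤ → MvPolynomial (Fin 2) ℝ, IsTwoVarBigJacobi α β γ δ 𝒥 := by
  choose p hp using exists_eval_eq_twoVarBigJacobi α β γ δ
  refine ⟨fun n k => if 0 ≤ k ∧ k ≤ n then p n.toNat k.toNat else 0, ⟨fun n k hk => ?_,
    fun n k h => if_neg h⟩, fun 𝒥 h𝒥 => ?_⟩
  · simpa [hk] using hp n k
  · funext n k
    by_cases h : 0 ≤ k ∧ k ≤ n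
    · lift k to ℕ using h.1
      lift n to ℕ using h.1.trans h.2
      have hk : k ≤ n := by exact_mod_cast h.2
      simp only [if_pos h, Int.toNat_natCast]
      exact mvPolynomial_eq_of_eval_eq δ fun x y hy hy' => by
        rw [h𝒥.1 n k hk x y hy hy', hp n k x y hy hy']
    · rw [h𝒥.2 n k h, if_neg h]

end

/-! ### The factor `ρ_k(y) J_k(x/y)` and the coefficients of the recurrences -/

lemma upCoeff_eq_sigma (β γ c : ℝ) (k : ℕ) :
    upCoeff k γ β c = (1 + (-1) ^ k * c) * sigma β γ k := by
  rw [upCoeff, sigma, phi]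
  split_ifs with h
  · rw [h.neg_one_pow]; ring
  · rw [(Nat.not_even_iff_odd.1 h).neg_one_pow]; ring

lemma downCoeff_eq_tau (β γ c : ℝ) (k : ℕ) :
    downCoeff k γ β c = (1 - (-1) ^ k * c) * tau β γ k := by
  rw [downCoeff, tau, phi]
  split_ifs with h
  · rw [h.neg_one_pow]; ring
  · rw [(Nat.not_even_iff_odd.1 h).neg_one_pow]; ring

lemma tau_zero (β γ : ℝ) : tau β γ 0 = 0 := by simp [tau, phi]

/-- The three-term recurrence of `J_k(·; γ, β, δ/y)` at `x/y`, multiplied by `y ρ_k(y)`. The ratios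
of consecutive `ρ_k` are `y ± δ`; one such factor is already present in the recurrence
coefficient of `J_{k-1}`, whence the square. -/
theorem mul_homJacobi {β γ δ : ℝ} (hβ : -1 < β) (hγ : -1 < γ) (k : ℕ) (x : ℝ) {y : ℝ}
    (hy : y ≠ 0) (hy' : y ^ 2 ≠ δ ^ 2) :
    x * homJacobi β γ δ k x y = sigma β γ k * homJacobi β γ δ (k + 1) x y +
      ((1 - sigma β γ k - tau β γ k) * y - dlt δ k * (sigma β γ k - tau β γ k)) *
        homJacobi β γ δ k x y +
      tau β γ k * (y - dlt δ k) ^ 2 * homJacobi β γ δ (k - 1) x y := by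
  have hc : 1 + δ / y ≠ 0 := fun h => hy' (by
    field_simp at h
    linear_combination (y - δ) * h)
  have hc' : 1 - δ / y ≠ 0 := fun h => hy' (by
    field_simp at h
    linear_combination (y + δ) * h)
  have h := mul_bigJacobi hγ hβ hc hc' k (x / y)
  rw [upCoeff_eq_sigma, downCoeff_eq_tau] at h
  have hx : y * (x / y) = x := mul_div_cancel₀ x hy
  have hd : y * (δ / y) = δ := mul_div_cancel₀ δ hy
  have hpred : tau β γ k * rho δ k y = tau β γ k * ((y - dlt δ k) * rho δ (k - 1) y) := by
    cases k with
    | zero => simp [tau_zero]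
    | succ k =>
      rw [rho_succ δ k hy, Nat.add_sub_cancel, dlt, pow_succ]
      ring
  simp only [homJacobi]
  rw [rho_succ δ k hy]
  rw [dlt] at hpred ⊢
  generalize bigJacobi k (x / y) γ β (δ / y) = J at *
  generalize bigJacobi (k + 1) (x / y) γ β (δ / y) = J₁ at *
  generalize bigJacobi (k - 1) (x / y) γ β (δ / y) = J₀ at *
  linear_combination (y * rho δ k y) * h - (rho δ k y * J) * hx +
    rho δ k y * (-1) ^ k *
      (sigma β γ k * J₁ - (sigma β γ k - tau β γ k) * J - tau β γ k * J₀) * hd +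
    (y - (-1) ^ k * δ) * J₀ * hpred

section Coefficients

variable {α β γ δ : ℝ}

lemma even_add_add_iff (k N : ℕ) : Even (k + N + k) ↔ Even N := by
  simp only [Nat.even_add]
  tauto

lemma coefA_eq (k N : ℕ) :
    coefA α β γ δ (k + N) k = upCoeff N α (2 * k + β + γ + 1) ((-1) ^ k * δ) := by
  simp only [coefA, upCoeff, dlt, even_add_add_iff, pow_add]
  split_ifs <;> (push_cast; ring)

lemma coefC_eq (k N : ℕ) :
    coefC α β γ δ (k + N) k = downCoeff N α (2 * k + β + γ + 1) ((-1) ^ k * δ) := by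
  simp only [coefC, downCoeff, dlt, even_add_add_iff, pow_add]
  split_ifs <;> (push_cast; ring)

lemma zee_eq (k N : ℕ) :
    zee α β γ δ (k + N) = (-1) ^ k * midCoeff N α (2 * k + β + γ + 1) ((-1) ^ k * δ) := by
  have h : ((-1 : ℝ) ^ k) * (-1) ^ k = 1 := by rw [← mul_pow]; simp
  rw [zee, midCoeff, mul_div_assoc']
  congr 1
  · push_cast
    rw [pow_add]
    linear_combination δ * (2 * N + α + (2 * k + β + γ + 1) + 1) * h
  · push_cast
    ring

lemma coefG_eq (k N : ℕ) :
    coefG α β γ δ (k + N) k = sigma β γ k *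
      ((1 + (-1) ^ N * ((-1) ^ k * δ)) /
        ((1 + (-1) ^ k * δ) * (2 * N + α + (2 * k + β + γ + 1) + 2)) *
      (if Even N then N + α + (2 * k + β + γ + 1) + 2 else N + α + (2 * k + β + γ + 1) + 1)) := by
  simp only [coefG, dlt, even_add_add_iff, pow_add]
  rw [show 2 * ((k + N : ℕ) : ℝ) + α + β + γ + 3 = 2 * N + α + (2 * k + β + γ + 1) + 2 by
    push_cast; ring]
  split_ifs <;> (push_cast; ring)

lemma coefT_eq (k N : ℕ) :
    coefT α β γ δ (k + N) k = -(sigma β γ k *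
      (2 * midCoeff N α (2 * k + β + γ + 1) ((-1) ^ k * δ) / (1 + (-1) ^ k * δ) *
      (if Even N then (N : ℝ) else N + α + (2 * k + β + γ + 1) + 1))) := by
  have h : ((-1 : ℝ) ^ k) * (-1) ^ k = 1 := by rw [← mul_pow]; simp
  simp only [coefT, dlt, even_add_add_iff, zee_eq, pow_succ]
  generalize midCoeff N α (2 * k + β + γ + 1) ((-1) ^ k * δ) = Z
  rw [show 2 * ((-1) ^ k * -1) * sigma β γ k * ((-1) ^ k * Z) =
    -(2 * sigma β γ k * Z) * ((-1) ^ k * (-1) ^ k) by ring, h]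
  split_ifs <;> (push_cast; ring)

lemma coefW_eq (k N : ℕ) :
    coefW α β γ δ (k + N) k = sigma β γ k *
      ((1 - (-1) ^ N * ((-1) ^ k * δ)) /
        ((1 + (-1) ^ k * δ) * (2 * N + α + (2 * k + β + γ + 1))) *
      (if Even N then (N : ℝ) else N - 1)) := by
  simp only [coefW, dlt, even_add_add_iff, pow_add]
  rw [show 2 * ((k + N : ℕ) : ℝ) + α + β + γ + 1 = 2 * N + α + (2 * k + β + γ + 1) by
    push_cast; ring]
  split_ifs <;> (push_cast; ring)

/-- The coefficients of the terms with index `k - 1` are matched with those of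
`sq_mul_bigJacobi_lower`; they are stated at `k + 1`, as they vanish at `k = 0`. -/
lemma coefE_succ_eq (k N : ℕ) :
    coefE α β γ δ (k + 1 + N) (k + 1) = tau β γ (k + 1) *
      ((1 + (-1) ^ k * δ) * (1 - (-1) ^ N * ((-1) ^ k * δ)) /
        (2 * N + α + (2 * k + β + γ + 1) + 4) *
      (if Even N then N + α + 1 else N + α + 2)) := by
  simp only [coefE, dlt, even_add_add_iff, pow_add]
  split_ifs <;> (push_cast; ring)

lemma coefR_succ_eq (k N : ℕ) :
    coefR α β γ δ (k + 1 + N) (k + 1) = tau β γ (k + 1) *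
      (2 * midCoeff N α (2 * k + β + γ + 1 + 2) (-((-1) ^ k * δ)) * (1 + (-1) ^ k * δ) *
      (if Even N then N + α + 1 else N + (2 * k + β + γ + 1) + 2)) := by
  have h : ((-1 : ℝ) ^ k) * (-1) ^ k = 1 := by rw [← mul_pow]; simp
  simp only [coefR, even_add_add_iff, zee_eq]
  rw [show 2 * ((k + 1 : ℕ) : ℝ) + β + γ + 1 = 2 * k + β + γ + 1 + 2 by push_cast; ring,
    show (-1) ^ (k + 1) * δ = -((-1) ^ k * δ) by ring]
  generalize midCoeff _ _ _ _ = Z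
  rw [pow_succ, show 2 * tau β γ (k + 1) * ((-1) ^ k * -1 * Z) * ((-1) ^ k * -1 - δ) =
    tau β γ (k + 1) * (2 * Z * ((-1) ^ k * (-1) ^ k + (-1) ^ k * δ)) by ring, h]
  split_ifs <;> (push_cast; ring)

lemma coefU_succ_eq (k N : ℕ) :
    coefU α β γ δ (k + 1 + N) (k + 1) = tau β γ (k + 1) *
      ((1 + (-1) ^ k * δ) * (1 + (-1) ^ N * ((-1) ^ k * δ)) /
        (2 * N + α + (2 * k + β + γ + 1) + 2) *
      (if Even N then N + (2 * k + β + γ + 1) + 1 else N + (2 * k + β + γ + 1) + 2)) := by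
  simp only [coefU, dlt, even_add_add_iff, pow_add]
  split_ifs <;> (push_cast; ring)

end Coefficients

end BigMinusOneJacobi

/-! ### The recurrence relations -/

open MvPolynomial BigMinusOneJacobi in
theorem proposition3p2 (α β γ δ : ℝ) (hα : -1 < α) (hβ : -1 < β) (hγ : -1 < γ)
    (hδ : δ ≠ 1) (hδ' : δ ≠ -1) :
    (∃! 𝒥 : ℤ → ℤ → MvPolynomial (Fin 2) ℝ, IsTwoVarBigJacobi α β γ δ 𝒥) ∧
    ∀ 𝒥 : ℤ → ℤ → MvPolynomial (Fin 2) ℝ, IsTwoVarBigJacobi α β γ δ 𝒥 →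
      ∀ n k : ℕ, k ≤ n →
        (X 1 * 𝒥 n k =
            C (coefA α β γ δ n k) * 𝒥 (n + 1) k
          + C (coefB α β γ δ n k) * 𝒥 n k
          + C (coefC α β γ δ n k) * 𝒥 (n - 1) k) ∧
        (X 0 * 𝒥 n k =
            C (coefE α β γ δ n k) * 𝒥 (n + 1) (k - 1)
          + C (coefF α β γ δ n k) * 𝒥 (n + 1) k
          + C (coefG α β γ δ n k) * 𝒥 (n + 1) (k + 1)
          + C (coefR α β γ δ n k) * 𝒥 n (k - 1)
          + C (coefS α β γ δ n k) * 𝒥 n k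
          + C (coefT α β γ δ n k) * 𝒥 n (k + 1)
          + C (coefU α β γ δ n k) * 𝒥 (n - 1) (k - 1)
          + C (coefV α β γ δ n k) * 𝒥 (n - 1) k
          + C (coefW α β γ δ n k) * 𝒥 (n - 1) (k + 1)) := by
  refine ⟨existsUnique_isTwoVarBigJacobi α β γ δ, fun 𝒥 h𝒥 n k hk => ?_⟩
  obtain ⟨N, rfl⟩ := Nat.exists_eq_add_of_le hk
  have hc : ∀ j : ℕ, 1 + (-1) ^ j * δ ≠ 0 ∧ 1 - (-1) ^ j * δ ≠ 0 := by
    intro j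
    have h1 : 1 + δ ≠ 0 := fun h => hδ' (by linarith)
    have h2 : 1 - δ ≠ 0 := fun h => hδ (by linarith)
    rcases neg_one_pow_eq_or ℝ j with h | h <;> rw [h]
    · simpa using ⟨h1, h2⟩
    · simpa [← sub_eq_add_neg] using ⟨h2, h1⟩
  have hb : ∀ j : ℕ, -1 < 2 * (j : ℝ) + β + γ + 1 := by
    intro j
    have : (0 : ℝ) ≤ j := j.cast_nonneg
    linarith
  -- It suffices to compare the values of both sides where the defining formula makes sense.
  have key : ∀ x y : ℝ, y ≠ 0 → y ^ 2 ≠ δ ^ 2 → ∀ V : ℤ → ℤ → ℝ,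
      (∀ i j : ℤ, V i j = eval ![x, y] (𝒥 i j)) →
      (y * V (k + N : ℕ) k = coefA α β γ δ (k + N) k * V ((k + N : ℕ) + 1) k +
        coefB α β γ δ (k + N) k * V (k + N : ℕ) k +
        coefC α β γ δ (k + N) k * V ((k + N : ℕ) - 1) k) ∧
      (x * V (k + N : ℕ) k = coefE α β γ δ (k + N) k * V ((k + N : ℕ) + 1) (k - 1) +
        coefF α β γ δ (k + N) k * V ((k + N : ℕ) + 1) k +
        coefG α β γ δ (k + N) k * V ((k + N : ℕ) + 1) (k + 1) +
        coefR α β γ δ (k + N) k * V (k + N : ℕ) (k - 1) +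
        coefS α β γ δ (k + N) k * V (k + N : ℕ) k +
        coefT α β γ δ (k + N) k * V (k + N : ℕ) (k + 1) +
        coefU α β γ δ (k + N) k * V ((k + N : ℕ) - 1) (k - 1) +
        coefV α β γ δ (k + N) k * V ((k + N : ℕ) - 1) k +
        coefW α β γ δ (k + N) k * V ((k + N : ℕ) - 1) (k + 1)) := by
    intro x y hy hy' V hV
    have hval : ∀ (i j : ℤ) (M l : ℕ), i = (l + M : ℕ) → j = l → V i j =
        bigJacobi M y α (2 * l + β + γ + 1) ((-1) ^ l * δ) * homJacobi β γ δ l x y := by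
      rintro _ _ M l rfl rfl
      rw [hV, h𝒥.1 _ _ (Nat.le_add_right l M) x y hy hy', twoVarBigJacobi_eq,
        Nat.add_sub_cancel_left]
    have h00 := hval (k + N : ℕ) k N k rfl rfl
    have h10 := hval ((k + N : ℕ) + 1) k (N + 1) k (by push_cast; ring) rfl
    -- The three-term recurrence in `y`.
    have hY : y * V (k + N : ℕ) k = coefA α β γ δ (k + N) k * V ((k + N : ℕ) + 1) k +
        coefB α β γ δ (k + N) k * V (k + N : ℕ) k +
        coefC α β γ δ (k + N) k * V ((k + N : ℕ) - 1) k := by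
      have hlast : coefC α β γ δ (k + N) k * V ((k + N : ℕ) - 1) k =
          coefC α β γ δ (k + N) k *
            (bigJacobi (N - 1) y α (2 * k + β + γ + 1) ((-1) ^ k * δ) *
              homJacobi β γ δ k x y) := by
        cases N with
        | zero =>
          rw [coefC_eq]
          simp [downCoeff]
        | succ N =>
          rw [hval ((k + (N + 1) : ℕ) - 1) k N k (by push_cast; ring) rfl, Nat.add_sub_cancel]
      have h := mul_bigJacobi hα (hb k) (hc k).1 (hc k).2 N y
      rw [hlast, h00, h10, coefB, coefA_eq, coefC_eq]
      linear_combination homJacobi β γ δ k x y * h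
    -- The terms with `k + 1`.
    have hU : sigma β γ k * bigJacobi N y α (2 * k + β + γ + 1) ((-1) ^ k * δ) *
          homJacobi β γ δ (k + 1) x y =
        coefG α β γ δ (k + N) k * V ((k + N : ℕ) + 1) (k + 1) +
        coefT α β γ δ (k + N) k * V (k + N : ℕ) (k + 1) +
        coefW α β γ δ (k + N) k * V ((k + N : ℕ) - 1) (k + 1) := by
      have hb' : 2 * ((k + 1 : ℕ) : ℝ) + β + γ + 1 = 2 * k + β + γ + 1 + 2 := by push_cast; ring
      have hs : (-1) ^ (k + 1) * δ = -((-1) ^ k * δ) := by ring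
      have hG := hval ((k + N : ℕ) + 1) (k + 1) N (k + 1) (by push_cast; ring) (by push_cast; ring)
      have hT : coefT α β γ δ (k + N) k * V (k + N : ℕ) (k + 1) =
          coefT α β γ δ (k + N) k *
            (bigJacobi (N - 1) y α (2 * (k + 1 : ℕ) + β + γ + 1) ((-1) ^ (k + 1) * δ) *
              homJacobi β γ δ (k + 1) x y) := by
        cases N with
        | zero =>
          rw [coefT_eq]
          simp
        | succ N =>
          rw [hval (k + (N + 1) : ℕ) (k + 1) N (k + 1) (by push_cast; ring) (by push_cast; ring),
            Nat.add_sub_cancel]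
      have hW : coefW α β γ δ (k + N) k * V ((k + N : ℕ) - 1) (k + 1) =
          coefW α β γ δ (k + N) k *
            (bigJacobi (N - 2) y α (2 * (k + 1 : ℕ) + β + γ + 1) ((-1) ^ (k + 1) * δ) *
              homJacobi β γ δ (k + 1) x y) := by
        match N with
        | 0 =>
          rw [coefW_eq]
          simp
        | 1 =>
          rw [coefW_eq]
          simp
        | N + 2 =>
          rw [hval ((k + (N + 2) : ℕ) - 1) (k + 1) N (k + 1) (by push_cast; ring)
            (by push_cast; ring), Nat.add_sub_cancel]
      have h := bigJacobi_raise hα (hb k) (hc k).1 (hc k).2 N y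
      rw [hT, hW, hG, hb', hs, coefG_eq, coefT_eq, coefW_eq]
      linear_combination sigma β γ k * homJacobi β γ δ (k + 1) x y * h
    -- The terms with `k - 1`.
    have hD : tau β γ k * (y - dlt δ k) ^ 2 *
          bigJacobi N y α (2 * k + β + γ + 1) ((-1) ^ k * δ) * homJacobi β γ δ (k - 1) x y =
        coefE α β γ δ (k + N) k * V ((k + N : ℕ) + 1) (k - 1) +
        coefR α β γ δ (k + N) k * V (k + N : ℕ) (k - 1) +
        coefU α β γ δ (k + N) k * V ((k + N : ℕ) - 1) (k - 1) := by
      cases k with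
      | zero => simp [coefE, coefR, coefU, tau_zero]
      | succ k =>
        have hb' : 2 * ((k + 1 : ℕ) : ℝ) + β + γ + 1 = 2 * k + β + γ + 1 + 2 := by
          push_cast; ring
        have hs : (-1) ^ (k + 1) * δ = -((-1) ^ k * δ) := by ring
        rw [hval ((k + 1 + N : ℕ) + 1) ((k + 1 : ℕ) - 1) (N + 2) k (by push_cast; ring)
            (by push_cast; ring),
          hval (k + 1 + N : ℕ) ((k + 1 : ℕ) - 1) (N + 1) k (by push_cast; ring)
            (by push_cast; ring),
          hval ((k + 1 + N : ℕ) - 1) ((k + 1 : ℕ) - 1) N k (by push_cast; ring)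
            (by push_cast; ring),
          Nat.add_sub_cancel, coefE_succ_eq, coefR_succ_eq, coefU_succ_eq, dlt, hb', hs]
        have h := sq_mul_bigJacobi_lower hα (hb k) (hc k).1 (hc k).2 N y
        linear_combination tau β γ (k + 1) * homJacobi β γ δ k x y * h
    refine ⟨hY, ?_⟩
    have h := mul_homJacobi hβ hγ k x hy hy'
    rw [coefF, coefS, coefV]
    linear_combination (1 - sigma β γ k - tau β γ k) * hY + hU + hD +
      bigJacobi N y α (2 * k + β + γ + 1) ((-1) ^ k * δ) * h +
      (x - (1 - sigma β γ k - tau β γ k) * y + dlt δ k * (sigma β γ k - tau β γ k)) * h00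
  refine ⟨mvPolynomial_eq_of_eval_eq δ fun x y hy hy' => ?_,
    mvPolynomial_eq_of_eval_eq δ fun x y hy hy' => ?_⟩
  · simpa using (key x y hy hy' (fun i j => eval ![x, y] (𝒥 i j)) fun _ _ => rfl).1
  · simpa using (key x y hy hy' (fun i j => eval ![x, y] (𝒥 i j)) fun _ _ => rfl).2
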